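/- Let $d$ be a positive integer, let $A$ be an Artinian local ring with infinite residue field, and let $S=\bigoplus_{\mathbf n\in\mathbb N^d}S_{\mathbf n}$ be a finitely generated standard $\mathbb N^d$-graded $A$-algebra, i.e. $S$ is a commutative ring of finite type over $A$, generated as an $A$-algebra by homogeneous elements whose degrees are unit vectors of $\mathbb N^d$. For a finitely generated $\mathbb N^d$-graded $S$-module $M=\bigoplus_{\mathbf n\in\mathbb N^d}M_{\mathbf n}$, there is a unique polynomial $P_M\in\mathbb Q[n_1,\dots,n_d]$ (the Hilbert polynomial) with $P_M(\mathbf n)=\ell_A(M_{\mathbf n})<\infty$ for all large $\mathbf n$ (all $\mathbf n\ge\mathbf n_0$ componentwise, for some $\mathbf n_0$), and it can be written uniquely as a finite sum $$P_M(\mathbf n)=\sum_{\mathbf k\in\mathbb N^d}e(M;\mathbf k)\binom{\mathbf n+\mathbf k}{\mathbf k},\qquad e(M;\mathbf k)\in\mathbb Z,\qquad \binom{\mathbf n+\mathbf k}{\mathbf k}=\prod_{i=1}^d\binom{n_i+k_i}{k_i}.$$ One says that the mixed multiplicity (of maximal degree) $e(M;\mathbf k)$ of $M$ of the type $\mathbf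 k$ is defined if $e(M;\mathbf h)=0$ for all $\mathbf h\in\mathbb N^d$ with $\mathbf h>\mathbf k$, i.e. $\mathbf h\ge\mathbf k$ componentwise and $\mathbf h\ne\mathbf k$. Let $0\to M'\to M\to M''\to 0$ be a short exact sequence of finitely generated $\mathbb N^d$-graded $S$-modules with degree-preserving homomorphisms, and let $\mathbf k\in\mathbb N^d$. Then the Hilbert polynomials of $M'$, $M$, $M''$ and their expansions above exist, and: (i) $e(M;\mathbf k)$ is defined if and only if both $e(M';\mathbf k)$ and $e(M'';\mathbf k)$ are defined. (ii) If $e(M;\mathbf k)$ is defined, then $e(M;\mathbf k)=e(M';\mathbf k)+e(M'';\mathbf k)$. -/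

import Mathlib

open Filter

noncomputable section

/-- The `ℕ^d`-graded `A`-algebra `S = ⨁ 𝒮 n` is finitely generated and standard: it is of finite
type over `A` and generated over `A` by elements whose degree is one of the unit vectors `e_i`. -/
def IsStandardGraded {d : ℕ} (A : Type*) {S : Type*} [CommRing A] [CommRing S] [Algebra A S]
    (𝒮 : (Fin d → ℕ) → Submodule A S) : Prop :=
  Algebra.FiniteType A S ∧
    Algebra.adjoin A (⋃ i : Fin d, (𝒮 (Pi.single i 1) : Set S)) = ⊤

/-- `P` is a Hilbert polynomial of the `ℕ^d`-graded module `M = ⨁ ℳ n`: for all large `n ∈ ℕ^d`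
(that is, for all `n ≥ n₀` componentwise, for some `n₀`), the length of `ℳ n` over `A` is finite
and equals `P(n)`. -/
def IsHilbertPolynomial {d : ℕ} (A : Type*) {M : Type*} [CommRing A] [AddCommGroup M] [Module A M]
    (ℳ : (Fin d → ℕ) → Submodule A M) (P : MvPolynomial (Fin d) ℚ) : Prop :=
  ∀ᶠ n : Fin d → ℕ in atTop, ∃ m : ℕ, Module.length A (ℳ n) = (m : ℕ∞) ∧
    MvPolynomial.eval (fun i => (n i : ℚ)) P = (m : ℚ)

open Classical in
/-- The Hilbert polynomial `P_M` (it is unique when it exists; `0` if there is none). -/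
def hilbertPolynomial {d : ℕ} (A : Type*) {M : Type*} [CommRing A] [AddCommGroup M] [Module A M]
    (ℳ : (Fin d → ℕ) → Submodule A M) : MvPolynomial (Fin d) ℚ :=
  if h : ∃ P, IsHilbertPolynomial A ℳ P then h.choose else 0

/-- The polynomial `binom(n + k, k) = ∏ i, (n_i + 1) ⋯ (n_i + k_i) / k_i!` in the variables
`n = (n_1, …, n_d)`. -/
def binomialPolynomial {d : ℕ} (k : Fin d → ℕ) : MvPolynomial (Fin d) ℚ :=
  ∏ i : Fin d, (MvPolynomial.C (((k i).factorial : ℚ)⁻¹) *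
    ∏ j ∈ Finset.range (k i), (MvPolynomial.X i + MvPolynomial.C ((j : ℚ) + 1)))

theorem eval_binomialPolynomial {d : ℕ} (k n : Fin d → ℕ) :
    MvPolynomial.eval (fun i => (n i : ℚ)) (binomialPolynomial k) =
      ∏ i, ((n i + k i).choose (k i) : ℚ) := by
  have key : ∀ a b : ℕ, ((b.factorial : ℚ)⁻¹) * ∏ j ∈ Finset.range b, ((a : ℚ) + ((j : ℚ) + 1)) =
      ((a + b).choose b : ℚ) := by
    intro a b
    have h : ((a + 1).ascFactorial b : ℚ) = ∏ j ∈ Finset.range b, ((a : ℚ) + ((j : ℚ) + 1)) := by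
      rw [Nat.ascFactorial_eq_prod_range]
      push_cast
      exact Finset.prod_congr rfl fun j _ => by ring
    rw [← h, Nat.ascFactorial_eq_factorial_mul_choose]
    have : (b.factorial : ℚ) ≠ 0 := by exact_mod_cast b.factorial_ne_zero
    push_cast
    field_simp
  simp only [binomialPolynomial, map_prod, map_mul, map_add, MvPolynomial.eval_C,
    MvPolynomial.eval_X]
  exact Finset.prod_congr rfl fun i _ => key (n i) (k i)

/-- The finite sum `∑ k, c k • binom(n + k, k)` as a polynomial in `n`. -/
def binomialSum {d : ℕ} (c : (Fin d → ℕ) →₀ ℤ) : MvPolynomial (Fin d) ℚ :=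
  c.sum fun k a => (a : ℚ) • binomialPolynomial k

open Classical in
/-- The integers `e(M; k)`, `k ∈ ℕ^d`: the coefficients in the expansion
`P_M(n) = ∑ k, e(M; k) binom(n + k, k)` (such an expansion is unique when it exists). -/
def mixedCoeff {d : ℕ} (A : Type*) {M : Type*} [CommRing A] [AddCommGroup M] [Module A M]
    (ℳ : (Fin d → ℕ) → Submodule A M) : (Fin d → ℕ) →₀ ℤ :=
  if h : ∃ c, binomialSum c = hilbertPolynomial A ℳ then h.choose else 0

/-- The mixed multiplicity of maximal degree `e(M; k)` of `M` of the type `k` is defined: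
`e(M; h) = 0` for all `h > k` (componentwise order on `ℕ^d`: `h ≥ k` and `h ≠ k`). -/
def MixedMultiplicityDefined {d : ℕ} (A : Type*) {M : Type*} [CommRing A] [AddCommGroup M]
    [Module A M] (ℳ : (Fin d → ℕ) → Submodule A M) (k : Fin d → ℕ) : Prop :=
  ∀ h : Fin d → ℕ, k < h → mixedCoeff A ℳ h = 0

/-- `P_M` is the Hilbert polynomial of `M`, with `P_M(n) = ∑ k, e(M; k) binom(n + k, k)`;
this says that neither `hilbertPolynomial` nor `mixedCoeff` has taken its default value. -/
def HasHilbertExpansion {d : ℕ} (A : Type*) {M : Type*} [CommRing A] [AddCommGroup M] [Module A M]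
    (ℳ : (Fin d → ℕ) → Submodule A M) : Prop :=
  IsHilbertPolynomial A ℳ (hilbertPolynomial A ℳ) ∧
    binomialSum (mixedCoeff A ℳ) = hilbertPolynomial A ℳ

end

/-! Length is additive in each degree and binomial expansions are unique, so the coefficients
satisfy `c = c' + c''`, which gives (ii). For (i), cancellation must be excluded: a coefficient
above which all others vanish is nonnegative, so two such coefficients with sum zero both vanish
(`forall_add_eq_zero_iff`).

Existence of the expansion and this nonnegativity are proved together, for all homogeneous
subquotients `N₂ / N₁` of `M` (`isEventuallyBinomial_subquotientHilbertFunction`). If a generator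
acts on `N₂ / N₁` neither as zero nor injectively, its kernel splits the subquotient. Otherwise
either each direction `i` has an injective generator of degree `e_i`, and the Hilbert function is
recovered from its differences (`isEventuallyBinomial_of_eventually_diff`), or some direction has
only generators acting as zero, and the Hilbert function is eventually zero. -/

noncomputable section

/-! ### Multi-indices and uniqueness of binomial expansions. -/

section Combinatorics

variable {d : ℕ}

theorem exists_add_single_of_ne_zero {k : Fin d → ℕ} {i : Fin d} (h : k i ≠ 0) :
    ∃ k' : Fin d → ℕ, k = k' + Pi.single i 1 := by
  refine ⟨k - Pi.single i 1, ?_⟩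
  ext j
  by_cases hj : j = i
  · subst hj
    simp
    omega
  · simp [hj]

theorem pi_nat_induction {p : (Fin d → ℕ) → Prop} (h0 : p 0)
    (hs : ∀ m i, p m → p (m + Pi.single i 1)) (m : Fin d → ℕ) : p m := by
  induction hn : ∑ i, m i generalizing m with
  | zero =>
    have : m = 0 := by
      ext i
      exact (Finset.sum_eq_zero_iff.mp hn) i (Finset.mem_univ i)
    exact this ▸ h0
  | succ n ih =>
    obtain ⟨i, -, hi⟩ : ∃ i ∈ Finset.univ, m i ≠ 0 :=
      Finset.exists_ne_zero_of_sum_ne_zero (by omega)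
    obtain ⟨m', rfl⟩ := exists_add_single_of_ne_zero hi
    refine hs m' i (ih m' ?_)
    simpa [Finset.sum_add_distrib] using hn

theorem lt_add_single (k : Fin d → ℕ) (i : Fin d) : k < k + Pi.single i 1 := by
  refine lt_of_le_of_ne le_self_add fun h => ?_
  have := congrFun h i
  simp at this

theorem tendsto_add_single_atTop (i : Fin d) :
    Tendsto (fun n : Fin d → ℕ => n + Pi.single i 1) atTop atTop :=
  tendsto_atTop_mono (fun _ => le_self_add) tendsto_id

/-- The value at `n` of `∑ k, c k • binom(n + k, k)`. -/
def binomialValue (n : Fin d → ℕ) : ((Fin d → ℕ) →₀ ℤ) →+ ℤ :=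
  Finsupp.liftAddHom fun k => AddMonoidHom.mulRight (∏ i, ((n i + k i).choose (k i) : ℤ))

theorem binomialValue_single (n k : Fin d → ℕ) (a : ℤ) :
    binomialValue n (Finsupp.single k a) = a * ∏ i, ((n i + k i).choose (k i) : ℤ) := by
  simp [binomialValue]

theorem eval_binomialSum (c : (Fin d → ℕ) →₀ ℤ) (n : Fin d → ℕ) :
    MvPolynomial.eval (fun i => (n i : ℚ)) (binomialSum c) = (binomialValue n c : ℚ) := by
  simp [binomialSum, binomialValue, Finsupp.sum, eval_binomialPolynomial]

/-- The operator on coefficients which corresponds to `F(n) ↦ F(n) - F(n - e_i)`. -/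
def coeffShift (i : Fin d) : ((Fin d → ℕ) →₀ ℤ) →+ ((Fin d → ℕ) →₀ ℤ) :=
  Finsupp.comapDomain.addMonoidHom (add_left_injective (Pi.single i 1))

@[simp]
theorem coeffShift_apply (i : Fin d) (c : (Fin d → ℕ) →₀ ℤ) (k : Fin d → ℕ) :
    coeffShift i c k = c (k + Pi.single i 1) := rfl

/-- Pascal's rule in the `i`-th factor; the other factors agree in all three products. -/
theorem prod_choose_add_single (n k : Fin d → ℕ) (i : Fin d) :
    (∏ j, (((n + Pi.single i 1 : Fin d → ℕ) j + (k + Pi.single i 1 : Fin d → ℕ) j).choose ((k + Pi.single i 1 : Fin d → ℕ) j) : ℤ)) =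
      ∏ j, ((n j + (k + Pi.single i 1 : Fin d → ℕ) j).choose ((k + Pi.single i 1 : Fin d → ℕ) j) : ℤ) +
      ∏ j, (((n + Pi.single i 1 : Fin d → ℕ) j + k j).choose (k j) : ℤ) := by
  have h : ∀ g : Fin d → ℤ, (∀ j ≠ i, g j = ((n j + k j).choose (k j) : ℤ)) →
      ∏ j, g j = g i * ∏ j ∈ Finset.univ.erase i, ((n j + k j).choose (k j) : ℤ) := fun g hg => by
    rw [← Finset.mul_prod_erase _ _ (Finset.mem_univ i)]
    congr 1
    exact Finset.prod_congr rfl fun j hj => hg j (Finset.ne_of_mem_erase hj)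
  rw [h _ fun j hj => by simp [hj], h _ fun j hj => by simp [hj], h _ fun j hj => by simp [hj],
    ← add_mul]
  congr 1
  have e1 : n i + 1 + (k i + 1) = (n i + k i + 1) + 1 := by ring
  have e2 : n i + (k i + 1) = n i + k i + 1 := by ring
  have e3 : n i + 1 + k i = n i + k i + 1 := by ring
  simp only [Pi.add_apply, Pi.single_eq_same, e1, e2, e3]
  rw [Nat.choose_succ_succ (n i + k i + 1)]
  push_cast
  ring

theorem binomialValue_add_single (c : (Fin d → ℕ) →₀ ℤ) (n : Fin d → ℕ) (i : Fin d) :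
    binomialValue (n + Pi.single i 1) c =
      binomialValue n c + binomialValue (n + Pi.single i 1) (coeffShift i c) := by
  induction c using Finsupp.induction_linear with
  | zero => simp
  | add f g hf hg => simp only [map_add, hf, hg]; ring
  | single k a =>
    by_cases hk : k i = 0
    · have h0 : coeffShift i (Finsupp.single k a) = 0 := by
        ext h
        rw [coeffShift_apply, Finsupp.single_eq_of_ne, Finsupp.zero_apply]
        rintro rfl
        simp at hk
      rw [h0, map_zero, add_zero, binomialValue_single, binomialValue_single]
      congr 1
      refine Finset.prod_congr rfl fun j _ => ?_
      by_cases hj : j = i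
      · subst hj
        simp [hk]
      · simp [hj]
    · obtain ⟨k, rfl⟩ := exists_add_single_of_ne_zero hk
      have h0 : coeffShift i (Finsupp.single (k + Pi.single i 1) a) = Finsupp.single k a := by
        ext h
        simp [Finsupp.single_apply]
      rw [h0, binomialValue_single, binomialValue_single, binomialValue_single,
        prod_choose_add_single]
      ring

theorem binomialValue_of_forall_eq_zero {c : (Fin d → ℕ) →₀ ℤ} (hc : ∀ h, 0 < h → c h = 0)
    (n : Fin d → ℕ) : binomialValue n c = c 0 := by
  have : c = Finsupp.single 0 (c 0) := by
    ext h
    rcases eq_or_ne h 0 with rfl | hh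
    · simp
    · rw [Finsupp.single_eq_of_ne hh]
      exact hc h (pos_iff_ne_zero.mpr hh)
  rw [this, binomialValue_single]
  simp

theorem eventually_binomialValue_coeffShift_eq_zero {c : (Fin d → ℕ) →₀ ℤ}
    (hc : ∀ᶠ n in atTop, binomialValue n c = 0) (i : Fin d) :
    ∀ᶠ n in atTop, binomialValue n (coeffShift i c) = 0 := by
  obtain ⟨m, hm⟩ := eventually_atTop.mp hc
  refine eventually_atTop.mpr ⟨m + Pi.single i 1, fun n hn => ?_⟩
  obtain ⟨q, rfl⟩ := exists_add_of_le hn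
  have h := binomialValue_add_single c (m + q) i
  rw [hm _ (le_add_right (le_add_right le_rfl)), hm _ (le_add_right le_rfl)] at h
  rw [add_right_comm]
  omega

/-- Repeated differencing moves the coefficient at `k` to the origin. There, the vanishing of all
higher coefficients makes the expansion constant. -/
theorem coeff_eq_zero_of_eventually_eq_zero (k : Fin d → ℕ) :
    ∀ c : (Fin d → ℕ) →₀ ℤ, (∀ᶠ n in atTop, binomialValue n c = 0) →
      (∀ h, k < h → c h = 0) → c k = 0 := by
  induction k using pi_nat_induction with
  | h0 =>
    intro c hc hk
    obtain ⟨n, hn⟩ := hc.exists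
    rwa [binomialValue_of_forall_eq_zero hk] at hn
  | hs k i ih =>
    intro c hc hk
    exact ih (coeffShift i c) (eventually_binomialValue_coeffShift_eq_zero hc i) fun h hh =>
      hk _ (add_lt_add_left hh _)

theorem eq_zero_of_eventually_binomialValue_eq_zero {c : (Fin d → ℕ) →₀ ℤ}
    (hc : ∀ᶠ n in atTop, binomialValue n c = 0) : c = 0 := by
  by_contra hne
  obtain ⟨k, hk⟩ := c.support.exists_maximal (Finsupp.support_nonempty_iff.mpr hne)
  refine Finsupp.mem_support_iff.mp hk.prop
    (coeff_eq_zero_of_eventually_eq_zero k c hc fun h hh => ?_)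
  by_contra h0
  exact hk.not_gt (Finsupp.mem_support_iff.mpr h0) hh

theorem eq_of_eventually_binomialValue_eq {c c' : (Fin d → ℕ) →₀ ℤ}
    (h : ∀ᶠ n in atTop, binomialValue n c = binomialValue n c') : c = c' := by
  refine sub_eq_zero.mp (eq_zero_of_eventually_binomialValue_eq_zero ?_)
  filter_upwards [h] with n hn
  rw [map_sub, hn, sub_self]

/-- The coefficients of maximal degree are nonnegative. -/
def NonnegAtMaximal (c : (Fin d → ℕ) →₀ ℤ) : Prop :=
  ∀ k, (∀ h, k < h → c h = 0) → 0 ≤ c k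

/-- If a coefficient above `k` were nonzero, take a maximal index above `k` in the union of the
supports. Both coefficients there are nonnegative with sum zero, hence both vanish. -/
theorem forall_add_eq_zero_iff {c c' : (Fin d → ℕ) →₀ ℤ} (hc : NonnegAtMaximal c)
    (hc' : NonnegAtMaximal c') (k : Fin d → ℕ) :
    (∀ h, k < h → (c + c') h = 0) ↔ (∀ h, k < h → c h = 0) ∧ (∀ h, k < h → c' h = 0) := by
  classical
  refine ⟨fun H => ?_, fun H h hh => by simp [H.1 h hh, H.2 h hh]⟩
  suffices ∀ h ∈ (c.support ∪ c'.support).filter (k < ·), False by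
    refine ⟨fun h hh => ?_, fun h hh => ?_⟩ <;> by_contra h0 <;> exact this h (by simp [hh, h0])
  intro h₀ hh₀
  obtain ⟨h, hmax⟩ := Finset.exists_maximal ⟨h₀, hh₀⟩
  obtain ⟨hmem, hkh⟩ := Finset.mem_filter.mp hmax.prop
  have key : ∀ h', h < h' → c h' = 0 ∧ c' h' = 0 := by
    intro h' hh'
    by_contra hne
    refine hmax.not_gt ?_ hh'
    simp only [Finset.mem_filter, Finset.mem_union, Finsupp.mem_support_iff]
    exact ⟨by tauto, hkh.trans hh'⟩
  have h1 := hc h fun h' hh' => (key h' hh').1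
  have h2 := hc' h fun h' hh' => (key h' hh').2
  have h3 := H h hkh
  simp only [Finset.mem_union, Finsupp.mem_support_iff] at hmem
  rw [Finsupp.add_apply] at h3
  omega

theorem NonnegAtMaximal.add {c c' : (Fin d → ℕ) →₀ ℤ} (hc : NonnegAtMaximal c)
    (hc' : NonnegAtMaximal c') : NonnegAtMaximal (c + c') := by
  intro k hk
  obtain ⟨h1, h2⟩ := (forall_add_eq_zero_iff hc hc' k).mp hk
  exact add_nonneg (hc k h1) (hc' k h2)

/-- `f(n)` is for large `n` given by a polynomial `∑ k, c k • binom(n + k, k)`, in which the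
coefficients of maximal degree are nonnegative. -/
def IsEventuallyBinomial (f : (Fin d → ℕ) → ℤ) : Prop :=
  ∃ c, NonnegAtMaximal c ∧ ∀ᶠ n in atTop, f n = binomialValue n c

theorem IsEventuallyBinomial.add {f g : (Fin d → ℕ) → ℤ} (hf : IsEventuallyBinomial f)
    (hg : IsEventuallyBinomial g) : IsEventuallyBinomial (f + g) := by
  obtain ⟨c, hc, hcf⟩ := hf
  obtain ⟨c', hc', hcg⟩ := hg
  refine ⟨c + c', hc.add hc', ?_⟩
  filter_upwards [hcf, hcg] with n h1 h2
  rw [Pi.add_apply, h1, h2, map_add]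

theorem isEventuallyBinomial_of_eventually_eq_zero {f : (Fin d → ℕ) → ℤ}
    (hf : ∀ᶠ n in atTop, f n = 0) : IsEventuallyBinomial f :=
  ⟨0, fun _ _ => le_rfl, by simpa using hf⟩

/-! ### Recovering a function from its differences. -/

theorem eventually_const_of_eventually_add_single {r : (Fin d → ℕ) → ℤ}
    (hr : ∀ i, ∀ᶠ n in atTop, r (n + Pi.single i 1) = r n) :
    ∃ a, ∀ᶠ n in atTop, r n = a := by
  obtain ⟨m, hm⟩ := eventually_atTop.mp (eventually_all.mpr hr)
  refine ⟨r m, eventually_atTop.mpr ⟨m, fun n hn => ?_⟩⟩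
  obtain ⟨q, rfl⟩ := exists_add_of_le hn
  clear hn
  induction q using pi_nat_induction with
  | h0 => simp
  | hs q i ih => rw [← add_assoc, hm _ (le_add_right le_rfl), ih]

/-- A discrete Poincaré lemma: commuting mixed differences make the family `c` integrable. -/
theorem exists_coeff_of_coeffShift_comm (c : Fin d → (Fin d → ℕ) →₀ ℤ)
    (hc : ∀ i j, coeffShift j (c i) = coeffShift i (c j)) :
    ∃ e, ∀ i, coeffShift i e = c i := by
  classical
  -- Any direction with `k i ≠ 0` may be used, by the compatibility `hc`. The value at the origin is
  -- a free constant of integration, set to `0`.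
  let F : (Fin d → ℕ) → ℤ := fun k =>
    if h : ∃ i, k i ≠ 0 then c h.choose (k - Pi.single h.choose 1) else 0
  have hF : ∀ k i, F (k + Pi.single i 1) = c i k := by
    intro k i
    have h : ∃ j, (k + Pi.single i 1 : Fin d → ℕ) j ≠ 0 := ⟨i, by simp⟩
    simp only [F, dif_pos h]
    obtain ⟨q, hq⟩ := exists_add_single_of_ne_zero h.choose_spec
    generalize h.choose = j at hq ⊢
    rw [hq, add_tsub_cancel_right]
    by_cases hij : i = j
    · subst hij
      rw [add_right_cancel hq]
    · have hqi : q i ≠ 0 := by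
        have := congrFun hq i
        simp [hij] at this
        omega
      obtain ⟨q, rfl⟩ := exists_add_single_of_ne_zero hqi
      have hk : k = q + Pi.single j 1 := by
        rw [add_right_comm] at hq
        exact add_right_cancel hq
      rw [hk]
      exact DFunLike.congr_fun (hc j i) q
  refine ⟨Finsupp.ofSupportFinite F ?_, fun i => Finsupp.ext fun k => hF k i⟩
  refine (Set.finite_iUnion fun i => ((c i).hasFiniteSupport.image (· + Pi.single i 1))).subset ?_
  intro k hk
  by_cases h : ∃ i, k i ≠ 0
  · obtain ⟨i, hi⟩ := h
    obtain ⟨q, rfl⟩ := exists_add_single_of_ne_zero hi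
    rw [Function.mem_support, hF] at hk
    exact Set.mem_iUnion.mpr ⟨i, q, hk, rfl⟩
  · simp [F, h] at hk

/-- A maximal coefficient at `k ≠ 0` is a maximal coefficient of some difference `g i`. If it sits
at `k = 0`, then `f` is eventually equal to it, and `0 ≤ f` applies. -/
theorem isEventuallyBinomial_of_eventually_diff {f : (Fin d → ℕ) → ℤ} (hf : ∀ n, 0 ≤ f n)
    {g : Fin d → (Fin d → ℕ) → ℤ} (hg : ∀ i, IsEventuallyBinomial (g i))
    (hfg : ∀ i, ∀ᶠ n in atTop, f (n + Pi.single i 1) = f n + g i (n + Pi.single i 1)) :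
    IsEventuallyBinomial f := by
  choose c hc hcg using hg
  have hdiff : ∀ i, ∀ᶠ n in atTop,
      f (n + Pi.single i 1) = f n + binomialValue (n + Pi.single i 1) (c i) := fun i => by
    filter_upwards [hfg i, (tendsto_add_single_atTop i).eventually (hcg i)] with n h1 h2
    rw [h1, h2]
  -- Comparing the two orders of the steps `e_i`, `e_j` shows that the mixed differences agree.
  have hdd : ∀ i j, ∀ᶠ n in atTop, f (n + Pi.single i 1 + Pi.single j 1) = f n +
      binomialValue (n + Pi.single i 1 + Pi.single j 1) (c i) +
      binomialValue (n + Pi.single i 1 + Pi.single j 1) (c j) -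
      binomialValue (n + Pi.single i 1 + Pi.single j 1) (coeffShift j (c i)) := fun i j => by
    filter_upwards [hdiff i, (tendsto_add_single_atTop i).eventually (hdiff j)] with n h1 h2
    rw [h2, h1, binomialValue_add_single (c i) (n + Pi.single i 1 : Fin d → ℕ) j]
    ring
  obtain ⟨e, he⟩ := exists_coeff_of_coeffShift_comm c fun i j => by
    refine eq_of_eventually_binomialValue_eq ?_
    obtain ⟨m, hm⟩ := eventually_atTop.mp ((hdd i j).and (hdd j i))
    refine eventually_atTop.mpr ⟨m + Pi.single i 1 + Pi.single j 1, fun n hn => ?_⟩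
    obtain ⟨q, rfl⟩ := exists_add_of_le hn
    obtain ⟨h1, h2⟩ := hm (m + q) (le_add_right le_rfl)
    have e1 : m + Pi.single i 1 + Pi.single j 1 + q = m + q + Pi.single i 1 + Pi.single j 1 := by
      abel
    rw [add_right_comm _ (Pi.single j 1)] at h2
    rw [e1]
    omega
  -- All differences of `f - e` vanish eventually, so only the constant coefficient of `e` needs
  -- correcting, by `a`.
  obtain ⟨a, ha⟩ := eventually_const_of_eventually_add_single
      (r := fun n => f n - binomialValue n e) fun i => by
    filter_upwards [hdiff i] with n hn
    rw [hn, binomialValue_add_single e, he]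
    ring
  have he' : ∀ i, coeffShift i (e + Finsupp.single 0 a) = c i := fun i => by
    rw [map_add, he, add_eq_left]
    ext k
    rw [coeffShift_apply, Finsupp.single_eq_of_ne (pos_iff_ne_zero.mp
      ((zero_le).trans_lt (lt_add_single k i))), Finsupp.zero_apply]
  have hfe : ∀ᶠ n in atTop, f n = binomialValue n (e + Finsupp.single 0 a) := by
    filter_upwards [ha] with n hn
    rw [map_add, binomialValue_single]
    simp
    omega
  refine ⟨_, fun k hk => ?_, hfe⟩
  by_cases h : ∃ i, k i ≠ 0
  · obtain ⟨i, hi⟩ := h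
    obtain ⟨k, rfl⟩ := exists_add_single_of_ne_zero hi
    rw [← coeffShift_apply, he']
    refine hc i k fun h hh => ?_
    rw [← he' i, coeffShift_apply]
    exact hk _ (add_lt_add_left hh _)
  · obtain rfl : k = 0 := by
      ext i
      simpa using not_exists.mp h i
    obtain ⟨n, hn⟩ := hfe.exists
    rw [← binomialValue_of_forall_eq_zero hk n, ← hn]
    exact hf n

/-! ### From eventual expansions to `hilbertPolynomial` and `mixedCoeff`. -/

section HilbertPolynomial

variable {A M : Type*} [CommRing A] [AddCommGroup M] [Module A M]

/-- A polynomial is determined by its values on a product of infinite sets, here a product of tails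
of `ℕ`. -/
theorem IsHilbertPolynomial.unique {ℳ : (Fin d → ℕ) → Submodule A M}
    {P Q : MvPolynomial (Fin d) ℚ} (hP : IsHilbertPolynomial A ℳ P)
    (hQ : IsHilbertPolynomial A ℳ Q) : P = Q := by
  obtain ⟨m, hm⟩ := eventually_atTop.mp (hP.and hQ)
  refine MvPolynomial.funext_set (fun i => (Nat.cast : ℕ → ℚ) '' Set.Ici (m i))
    (fun i => (Set.Ici_infinite (m i)).image Nat.cast_injective.injOn) fun x hx => ?_
  choose n hn hnx using fun i => hx i (Set.mem_univ i)
  obtain rfl : (fun i => (n i : ℚ)) = x := funext hnx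
  obtain ⟨⟨a, ha, haP⟩, ⟨b, hb, hbQ⟩⟩ := hm n hn
  rw [haP, hbQ, Nat.cast_inj]
  exact_mod_cast ha.symm.trans hb

theorem hasHilbertExpansion_and_mixedCoeff_eq {ℳ : (Fin d → ℕ) → Submodule A M}
    {c : (Fin d → ℕ) →₀ ℤ} (hfin : ∀ n, Module.length A (ℳ n) ≠ ⊤)
    (hc : ∀ᶠ n in atTop, ((Module.length A (ℳ n)).toNat : ℤ) = binomialValue n c) :
    HasHilbertExpansion A ℳ ∧ mixedCoeff A ℳ = c := by
  have hP : IsHilbertPolynomial A ℳ (binomialSum c) := by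
    unfold IsHilbertPolynomial
    filter_upwards [hc] with n hn
    refine ⟨_, (ENat.natCast_toNat (hfin n)).symm, ?_⟩
    rw [eval_binomialSum, ← hn, Int.cast_natCast]
  have hex : ∃ P, IsHilbertPolynomial A ℳ P := ⟨_, hP⟩
  have hH : hilbertPolynomial A ℳ = binomialSum c := by
    rw [hilbertPolynomial, dif_pos hex]
    exact hex.choose_spec.unique hP
  have hex' : ∃ c, binomialSum c = hilbertPolynomial A ℳ := ⟨c, hH.symm⟩
  have hspec : binomialSum (mixedCoeff A ℳ) = hilbertPolynomial A ℳ := by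
    rw [mixedCoeff, dif_pos hex']
    exact hex'.choose_spec
  refine ⟨⟨hH ▸ hP, hspec⟩, eq_of_eventually_binomialValue_eq (Eventually.of_forall fun n => ?_)⟩
  have := congrArg (MvPolynomial.eval fun i => (n i : ℚ)) (hspec.trans hH)
  rw [eval_binomialSum, eval_binomialSum] at this
  exact_mod_cast this

end HilbertPolynomial

end Combinatorics

/-! ### Graded modules and their homogeneous components. -/

section Graded

theorem exists_finset_subset_mem_adjoin {A S : Type*} [CommRing A] [CommRing S] [Algebra A S]
    {U : Set S} {s : S} (hs : s ∈ Algebra.adjoin A U) :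
    ∃ t : Finset S, ↑t ⊆ U ∧ s ∈ Algebra.adjoin A (t : Set S) := by
  classical
  have hmono : ∀ {t t' : Finset S}, t ⊆ t' →
      Algebra.adjoin A (t : Set S) ≤ Algebra.adjoin A (t' : Set S) :=
    fun h => Algebra.adjoin_mono (Finset.coe_subset.mpr h)
  induction hs using Algebra.adjoin_induction with
  | mem x hx => exact ⟨{x}, by simpa using hx, Algebra.subset_adjoin (by simp)⟩
  | algebraMap r => exact ⟨∅, by simp, Subalgebra.algebraMap_mem _ r⟩
  | add x y _ _ hx hy =>
    obtain ⟨t, ht, hxt⟩ := hx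
    obtain ⟨t', ht', hyt⟩ := hy
    exact ⟨t ∪ t', by simp [ht, ht'], add_mem (hmono Finset.subset_union_left hxt)
      (hmono Finset.subset_union_right hyt)⟩
  | mul x y _ _ hx hy =>
    obtain ⟨t, ht, hxt⟩ := hx
    obtain ⟨t', ht', hyt⟩ := hy
    exact ⟨t ∪ t', by simp [ht, ht'], mul_mem (hmono Finset.subset_union_left hxt)
      (hmono Finset.subset_union_right hyt)⟩

/-- Each member of a finite generating set involves only finitely many elements of `U`; their union
suffices. -/
theorem exists_finset_subset_adjoin_eq_top {A S : Type*} [CommRing A] [CommRing S] [Algebra A S]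
    [hfin : Algebra.FiniteType A S] {U : Set S} (hU : Algebra.adjoin A U = ⊤) :
    ∃ t : Finset S, ↑t ⊆ U ∧ Algebra.adjoin A (t : Set S) = ⊤ := by
  classical
  obtain ⟨F, hF⟩ := hfin.out
  choose t ht hst using fun s : S =>
    exists_finset_subset_mem_adjoin (A := A) (hU ▸ Algebra.mem_top : s ∈ Algebra.adjoin A U)
  refine ⟨F.biUnion t, by simp [ht], top_le_iff.mp (hF ▸ Algebra.adjoin_le fun s hs => ?_)⟩
  exact Algebra.adjoin_mono (Finset.coe_subset.mpr (Finset.subset_biUnion_of_mem t hs)) (hst s)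

/-- If `Q = φ(P) + R` and `K` is the kernel of `P → Q / R`, then
`ℓ(P) + ℓ(R) = ℓ(K) + ℓ(Q)`. -/
theorem length_add_length_of_map {A M : Type*} [CommRing A] [AddCommGroup M] [Module A M]
    (φ : M →ₗ[A] M) {P R K Q : Submodule A M} (hK : P ⊓ R.comap φ = K) (hQ : P.map φ ⊔ R = Q) :
    Module.length A P + Module.length A R = Module.length A K + Module.length A Q := by
  subst hK hQ
  rw [← Module.length_prod]
  -- The short exact sequence is `0 → K → P × R → Q → 0` with maps `p ↦ (p, -φ p)` and `(p, r) ↦ φ p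
  -- + r`.
  let f : ↥(P ⊓ R.comap φ) →ₗ[A] P × R :=
    (Submodule.inclusion inf_le_left).prod
      (-(φ.restrict (p := P ⊓ R.comap φ) (q := R) fun x hx => hx.2))
  let g : P × R →ₗ[A] ↥(P.map φ ⊔ R) :=
    (φ.restrict fun x hx => Submodule.mem_sup_left (Submodule.mem_map_of_mem hx)).coprod
      (Submodule.inclusion le_sup_right)
  refine Module.length_eq_add_of_exact f g (fun x y h => ?_) (fun z => ?_) (fun z => ?_)
  · have := congrArg (fun p : P × R => (p.1 : M)) h
    exact Subtype.ext this
  · obtain ⟨z, hz⟩ := z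
    obtain ⟨y, hy, r, hr, rfl⟩ := Submodule.mem_sup.mp hz
    obtain ⟨p, hp, rfl⟩ := hy
    exact ⟨(⟨p, hp⟩, ⟨r, hr⟩), rfl⟩
  · obtain ⟨⟨p, hp⟩, ⟨r, hr⟩⟩ := z
    have hg : g (⟨p, hp⟩, ⟨r, hr⟩) = 0 ↔ φ p + r = 0 := by
      rw [← Subtype.coe_inj]
      rfl
    rw [hg]
    constructor
    · intro h
      have h' : φ p = -r := eq_neg_of_add_eq_zero_left h
      refine ⟨⟨p, hp, ?_⟩, ?_⟩
      · change φ p ∈ R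
        rw [h']
        exact neg_mem hr
      · refine Prod.ext rfl (Subtype.ext ?_)
        change -φ p = r
        rw [h', neg_neg]
    · rintro ⟨⟨q, hq⟩, h⟩
      have h1 : q = p := congrArg (fun p : P × R => (p.1 : M)) h
      have h2 : -φ q = r := congrArg (fun p : P × R => (p.2 : M)) h
      rw [← h2, h1, add_neg_cancel]

variable {d : ℕ} {A S M : Type*} [CommRing A] [CommRing S] [Algebra A S]
  (𝒮 : (Fin d → ℕ) → Submodule A S)
  [AddCommGroup M] [Module A M] [Module S M]
  (ℳ : (Fin d → ℕ) → Submodule A M) [DirectSum.Decomposition ℳ]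

theorem decompose_smul_add [SetLike.GradedSMul 𝒮 ℳ] {x : S} {e : Fin d → ℕ} (hx : x ∈ 𝒮 e)
    (m : M) (n : Fin d → ℕ) :
    (DirectSum.decompose ℳ (x • m) (n + e) : M) = x • (DirectSum.decompose ℳ m n : M) := by
  induction m using DirectSum.Decomposition.inductionOn ℳ with
  | zero => simp
  | @homogeneous j m =>
    have hxm : x • (m : M) ∈ ℳ (j + e) := by
      have := SetLike.GradedSMul.smul_mem hx m.2
      rwa [vadd_eq_add, add_comm] at this
    by_cases hj : j = n
    · subst hj
      rw [DirectSum.decompose_of_mem_same ℳ hxm, DirectSum.decompose_of_mem_same ℳ m.2]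
    · rw [DirectSum.decompose_of_mem_ne ℳ hxm fun h => hj (add_right_cancel h),
        DirectSum.decompose_of_mem_ne ℳ m.2 hj, smul_zero]
  | add m m' hm hm' =>
    rw [smul_add, DirectSum.decompose_add, DirectSum.decompose_add]
    simp only [DirectSum.add_apply, Submodule.coe_add, hm, hm', smul_add]

theorem decompose_smul_eq_zero [SetLike.GradedSMul 𝒮 ℳ] {x : S} {e : Fin d → ℕ} (hx : x ∈ 𝒮 e)
    (m : M) {n : Fin d → ℕ} (hn : ∀ q, q + e ≠ n) :
    (DirectSum.decompose ℳ (x • m) n : M) = 0 := by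
  induction m using DirectSum.Decomposition.inductionOn ℳ with
  | zero => simp
  | @homogeneous j m =>
    have hxm : x • (m : M) ∈ ℳ (j + e) := by
      have := SetLike.GradedSMul.smul_mem hx m.2
      rwa [vadd_eq_add, add_comm] at this
    exact DirectSum.decompose_of_mem_ne ℳ hxm (hn j)
  | add m m' hm hm' =>
    rw [smul_add, DirectSum.decompose_add]
    simp only [DirectSum.add_apply, Submodule.coe_add, hm, hm', add_zero]

theorem exists_finset_homogeneous_generators [IsNoetherian S M] {N : Submodule S M}
    (hN : N.IsHomogeneous ℳ) :
    ∃ T : Finset ((Fin d → ℕ) × M), (∀ p ∈ T, p.2 ∈ ℳ p.1 ∧ p.2 ∈ N) ∧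
      Submodule.span S (Prod.snd '' (T : Set ((Fin d → ℕ) × M))) = N := by
  classical
  obtain ⟨F, hF⟩ := IsNoetherian.noetherian N
  have hFN : ∀ t ∈ F, t ∈ N := fun t ht => hF ▸ Submodule.subset_span ht
  let T : Finset ((Fin d → ℕ) × M) := F.biUnion fun t =>
    (DirectSum.decompose ℳ t).support.image fun n => (n, (DirectSum.decompose ℳ t n : M))
  have hT : ∀ p ∈ T, p.2 ∈ ℳ p.1 ∧ p.2 ∈ N := by
    intro p hp
    obtain ⟨t, ht, hp⟩ := Finset.mem_biUnion.mp hp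
    obtain ⟨n, -, rfl⟩ := Finset.mem_image.mp hp
    exact ⟨SetLike.coe_mem _, hN n (hFN t ht)⟩
  refine ⟨T, hT, le_antisymm (Submodule.span_le.mpr ?_) ?_⟩
  · rintro _ ⟨p, hp, rfl⟩
    exact (hT p hp).2
  · conv_lhs => rw [← hF]
    refine Submodule.span_le.mpr fun t ht => ?_
    rw [← DirectSum.sum_support_decompose ℳ t]
    refine sum_mem fun n hn => Submodule.subset_span ⟨(n, _), ?_, rfl⟩
    exact Finset.mem_biUnion.mpr ⟨t, ht, Finset.mem_image.mpr ⟨n, hn, rfl⟩⟩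

/-- The elements of `N₂` which `x` multiplies into `N₁`. -/
def smulKernel (x : S) (N₁ N₂ : Submodule S M) : Submodule S M :=
  N₂ ⊓ N₁.comap (LinearMap.lsmul S M x)

/-- The submodule `x N₂ + N₁`. -/
def smulImage (x : S) (N₁ N₂ : Submodule S M) : Submodule S M :=
  N₂.map (LinearMap.lsmul S M x) ⊔ N₁

theorem isHomogeneous_smulKernel [SetLike.GradedSMul 𝒮 ℳ] {x : S} {e : Fin d → ℕ} (hx : x ∈ 𝒮 e)
    {N₁ N₂ : Submodule S M} (h₁ : N₁.IsHomogeneous ℳ) (h₂ : N₂.IsHomogeneous ℳ) :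
    (smulKernel x N₁ N₂).IsHomogeneous ℳ := by
  intro n m hm
  refine ⟨h₂ n hm.1, ?_⟩
  change x • (DirectSum.decompose ℳ m n : M) ∈ N₁
  rw [← decompose_smul_add 𝒮 ℳ hx]
  exact h₁ _ hm.2

theorem isHomogeneous_smulImage [SetLike.GradedSMul 𝒮 ℳ] {x : S} {e : Fin d → ℕ} (hx : x ∈ 𝒮 e)
    {N₁ N₂ : Submodule S M} (h₁ : N₁.IsHomogeneous ℳ) (h₂ : N₂.IsHomogeneous ℳ) :
    (smulImage x N₁ N₂).IsHomogeneous ℳ := by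
  intro n m hm
  obtain ⟨y, ⟨z, hz, rfl⟩, w, hw, rfl⟩ := Submodule.mem_sup.mp hm
  rw [DirectSum.decompose_add]
  refine add_mem ?_ (Submodule.mem_sup_right (h₁ n hw))
  rw [LinearMap.lsmul_apply]
  by_cases hn : ∃ q, q + e = n
  · obtain ⟨q, rfl⟩ := hn
    rw [decompose_smul_add 𝒮 ℳ hx]
    exact Submodule.mem_sup_left ⟨_, h₂ q hz, rfl⟩
  · rw [decompose_smul_eq_zero 𝒮 ℳ hx z (not_exists.mp hn)]
    exact zero_mem _

variable [IsScalarTower A S M]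

/-- The homogeneous component of degree `n` of a submodule. -/
def gradedPiece (N : Submodule S M) (n : Fin d → ℕ) : Submodule A M :=
  N.restrictScalars A ⊓ ℳ n

variable {ℳ} in
theorem mem_gradedPiece {N : Submodule S M} {n : Fin d → ℕ} {m : M} :
    m ∈ gradedPiece ℳ N n ↔ m ∈ N ∧ m ∈ ℳ n := Iff.rfl

variable {X : Finset S}

/-- The graded module generated by homogeneous elements `T` over a standard graded algebra
generated by `X` lies in each family of subgroups which contains `T` and is stable under `X`. -/
theorem decompose_mem_of_generators [SetLike.GradedSMul 𝒮 ℳ]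
    (hX : ∀ x ∈ X, ∃ i, x ∈ 𝒮 (Pi.single i 1)) (hXtop : Algebra.adjoin A (X : Set S) = ⊤)
    {T : Set ((Fin d → ℕ) × M)} (hT : ∀ p ∈ T, p.2 ∈ ℳ p.1)
    (Q : (Fin d → ℕ) → Submodule A M) (hTQ : ∀ p ∈ T, p.2 ∈ Q p.1)
    (hXQ : ∀ x ∈ X, ∀ i, x ∈ 𝒮 (Pi.single i 1) → ∀ n, ∀ m ∈ Q n, x • m ∈ Q (n + Pi.single i 1))
    {m : M} (hm : m ∈ Submodule.span S (Prod.snd '' T)) (n : Fin d → ℕ) :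
    (DirectSum.decompose ℳ m n : M) ∈ Q n := by
  have hsmul : ∀ s : S, ∀ m : M, (∀ n, (DirectSum.decompose ℳ m n : M) ∈ Q n) →
      ∀ n, (DirectSum.decompose ℳ (s • m) n : M) ∈ Q n := by
    intro s
    have hs : s ∈ Algebra.adjoin A (X : Set S) := hXtop ▸ Algebra.mem_top
    induction hs using Algebra.adjoin_induction with
    | mem x hx =>
      intro m hm n
      obtain ⟨i, hi⟩ := hX x hx
      by_cases hn : ∃ q : Fin d → ℕ, q + Pi.single i 1 = n
      · obtain ⟨q, rfl⟩ := hn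
        rw [decompose_smul_add 𝒮 ℳ hi]
        exact hXQ x hx i hi q _ (hm q)
      · rw [decompose_smul_eq_zero 𝒮 ℳ hi m (not_exists.mp hn)]
        exact zero_mem _
    | algebraMap r =>
      intro m hm n
      rw [algebraMap_smul, DirectSum.decompose_smul]
      exact (Q n).smul_mem r (hm n)
    | add x y _ _ hx hy =>
      intro m hm n
      rw [add_smul, DirectSum.decompose_add]
      exact add_mem (hx m hm n) (hy m hm n)
    | mul x y _ _ hx hy =>
      intro m hm
      rw [mul_smul]
      exact hx _ (hy m hm)
  induction hm using Submodule.span_induction generalizing n with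
  | mem t ht =>
    obtain ⟨p, hp, rfl⟩ := ht
    by_cases hn : p.1 = n
    · subst hn
      rw [DirectSum.decompose_of_mem_same ℳ (hT p hp)]
      exact hTQ p hp
    · rw [DirectSum.decompose_of_mem_ne ℳ (hT p hp) hn]
      exact zero_mem _
  | zero => simp
  | add x y _ _ hx hy =>
    rw [DirectSum.decompose_add]
    exact add_mem (hx n) (hy n)
  | smul s m _ hm => exact hsmul s m hm n

/-- The products of elements of `X` of degrees `e_i` with an element of `T`. -/
inductive IsMonomialMultiple (X : Finset S) (T : Set ((Fin d → ℕ) × M)) :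
    (Fin d → ℕ) → M → Prop
  | of (p : (Fin d → ℕ) × M) : p ∈ T → IsMonomialMultiple X T p.1 p.2
  | smul (n : Fin d → ℕ) (m : M) (x : S) (i : Fin d) : x ∈ X → IsMonomialMultiple X T n m →
      IsMonomialMultiple X T (n + Pi.single i 1) (x • m)

/-- Induction on the total degree, which each factor from `X` raises by one. -/
theorem finite_setOf_isMonomialMultiple {T : Set ((Fin d → ℕ) × M)} (hT : T.Finite)
    (n : Fin d → ℕ) : {m | IsMonomialMultiple X T n m}.Finite := by
  induction hs : ∑ i, n i generalizing n with
  | zero =>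
    refine (hT.image Prod.snd).subset fun m hm => ?_
    induction hm with
    | of p hp => exact ⟨p, hp, rfl⟩
    | smul n m x i => simp [Finset.sum_add_distrib] at hs
  | succ s ih =>
    have hfin : ∀ i : Fin d, {m | ∃ n' : Fin d → ℕ, n = n' + Pi.single i 1 ∧
        IsMonomialMultiple X T n' m}.Finite := fun i => by
      by_cases hn : ∃ n' : Fin d → ℕ, n = n' + Pi.single i 1
      · obtain ⟨q, rfl⟩ := hn
        refine (ih q (by simpa [Finset.sum_add_distrib] using hs)).subset ?_
        rintro m ⟨q', hq, hm⟩
        rwa [Set.mem_ofPred_eq, add_right_cancel hq]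
      · refine Set.finite_empty.subset ?_
        rintro m ⟨q', hq, -⟩
        exact hn ⟨q', hq⟩
    refine ((hT.image Prod.snd).union (X.finite_toSet.image2 (fun x (m : M) => x • m)
      (Set.finite_iUnion hfin))).subset fun m hm => ?_
    cases hm with
    | of p hp => exact Or.inl ⟨p, hp, rfl⟩
    | smul n m x i hx hm => exact Or.inr ⟨x, hx, m, Set.mem_iUnion.mpr ⟨i, n, rfl, hm⟩, rfl⟩

theorem finite_graded_component [IsNoetherian S M] [SetLike.GradedSMul 𝒮 ℳ]
    (hX : ∀ x ∈ X, ∃ i, x ∈ 𝒮 (Pi.single i 1)) (hXtop : Algebra.adjoin A (X : Set S) = ⊤)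
    (n : Fin d → ℕ) : ∃ Q : Submodule A M, Q.FG ∧ ℳ n ≤ Q := by
  obtain ⟨T, hT, hTtop⟩ := exists_finset_homogeneous_generators (N := (⊤ : Submodule S M)) ℳ
    fun _ _ _ => Submodule.mem_top
  refine ⟨Submodule.span A {m | IsMonomialMultiple X (T : Set ((Fin d → ℕ) × M)) n m},
    Submodule.fg_span (finite_setOf_isMonomialMultiple T.finite_toSet n), fun m hm => ?_⟩
  rw [← DirectSum.decompose_of_mem_same ℳ hm]
  refine decompose_mem_of_generators 𝒮 ℳ hX hXtop (T := T) (fun p hp => (hT p hp).1)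
    (fun n => Submodule.span A {m | IsMonomialMultiple X (T : Set ((Fin d → ℕ) × M)) n m})
    (fun p hp => Submodule.subset_span (.of p hp)) ?_ (hTtop ▸ Submodule.mem_top) n
  intro x hx i _ n m hm
  induction hm using Submodule.span_induction with
  | mem m hm => exact Submodule.subset_span (.smul n m x i hx hm)
  | zero => simp
  | add y z _ _ hy hz => rw [smul_add]; exact add_mem hy hz
  | smul a m _ hm => rw [smul_comm]; exact Submodule.smul_mem _ a hm

theorem length_gradedPiece_ne_top [IsArtinianRing A] [IsNoetherian S M] [SetLike.GradedSMul 𝒮 ℳ]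
    (hX : ∀ x ∈ X, ∃ i, x ∈ 𝒮 (Pi.single i 1)) (hXtop : Algebra.adjoin A (X : Set S) = ⊤)
    {n : Fin d → ℕ} {P : Submodule A M} (hP : P ≤ ℳ n) : Module.length A P ≠ ⊤ := by
  obtain ⟨Q, hQ, hnQ⟩ := finite_graded_component 𝒮 ℳ hX hXtop n
  have : Module.Finite A Q := Module.Finite.iff_fg.mpr hQ
  have : IsNoetherian A P := isNoetherian_of_le (hP.trans hnQ)
  have : IsArtinian A P := isArtinian_of_le (hP.trans hnQ)
  exact Module.length_ne_top

/-- Let `b` bound the `i`-th degrees of homogeneous generators of `N₂`. Passing beyond `b` requires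
multiplying by an element of `X` of degree `e_i`, which carries `N₂` into `N₁`. -/
theorem exists_bound_mem_of_smul_mem [IsNoetherian S M] [SetLike.GradedSMul 𝒮 ℳ]
    (hX : ∀ x ∈ X, ∃ i, x ∈ 𝒮 (Pi.single i 1)) (hXtop : Algebra.adjoin A (X : Set S) = ⊤)
    {N₁ N₂ : Submodule S M} (hle : N₁ ≤ N₂) (hN₂ : N₂.IsHomogeneous ℳ) (i : Fin d)
    (hi : ∀ x ∈ X, x ∈ 𝒮 (Pi.single i 1) → ∀ m ∈ N₂, x • m ∈ N₁) :
    ∃ b : ℕ, ∀ n : Fin d → ℕ, b < n i → ∀ m ∈ N₂, m ∈ ℳ n → m ∈ N₁ := by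
  classical
  obtain ⟨T, hT, hspan⟩ := exists_finset_homogeneous_generators ℳ hN₂
  let b := T.sup fun p => p.1 i
  let Q : (Fin d → ℕ) → Submodule A M := fun n =>
    if n i ≤ b then N₂.restrictScalars A else N₁.restrictScalars A
  have hQ : ∀ n, ∀ m ∈ Q n, m ∈ N₂ := fun n m hm => by
    dsimp only [Q] at hm
    split_ifs at hm
    exacts [hm, hle hm]
  refine ⟨b, fun n hn m hm hmn => ?_⟩
  have key := decompose_mem_of_generators 𝒮 ℳ hX hXtop (T := T) (fun p hp => (hT p hp).1) Q
    (fun p hp => ?_) (fun x hx j hj n m hm => ?_) (hspan.symm ▸ hm) n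
  · rw [DirectSum.decompose_of_mem_same ℳ hmn] at key
    simp only [Q, if_neg hn.not_ge] at key
    exact key
  · have hb : p.1 i ≤ b := Finset.le_sup (f := fun p : (Fin d → ℕ) × M => p.1 i) hp
    simp only [Q, if_pos hb]
    exact (hT p hp).2
  · by_cases hb : (n + Pi.single j 1 : Fin d → ℕ) i ≤ b
    · simp only [Q, if_pos hb]
      exact N₂.smul_mem x (hQ n m hm)
    · simp only [Q, if_neg hb]
      by_cases hij : j = i
      · subst hij
        exact hi x hx hj m (hQ n m hm)
      · have hb' : ¬ n i ≤ b := by simpa [Ne.symm hij] using hb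
        simp only [Q, if_neg hb'] at hm
        exact N₁.smul_mem x hm

/-! ### Hilbert functions of subquotients. -/

/-- Multiplication by `x` on `N₂ / N₁` has kernel `smulKernel / N₁` and cokernel `N₂ / smulImage`.
The resulting length count is written without subtraction. -/
theorem length_gradedPiece_smulImage [SetLike.GradedSMul 𝒮 ℳ] {x : S} {e : Fin d → ℕ}
    (hx : x ∈ 𝒮 e) {N₁ N₂ : Submodule S M} (h₁ : N₁.IsHomogeneous ℳ) (h₂ : N₂.IsHomogeneous ℳ)
    (n : Fin d → ℕ) :
    Module.length A (gradedPiece ℳ N₂ n) + Module.length A (gradedPiece ℳ N₁ (n + e)) =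
      Module.length A (gradedPiece ℳ (smulKernel x N₁ N₂) n) +
        Module.length A (gradedPiece ℳ (smulImage x N₁ N₂) (n + e)) := by
  have hsmul : ∀ m ∈ ℳ n, x • m ∈ ℳ (n + e) := fun m hm => by
    have := SetLike.GradedSMul.smul_mem hx hm
    rwa [vadd_eq_add, add_comm] at this
  refine length_add_length_of_map ((LinearMap.lsmul S M x).restrictScalars A) ?_ ?_
  · ext m
    exact ⟨fun h => ⟨⟨h.1.1, h.2.1⟩, h.1.2⟩, fun h => ⟨⟨h.1.1, h.2⟩, h.1.2, hsmul m h.2⟩⟩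
  · refine le_antisymm (sup_le ?_ ?_) ?_
    · rintro _ ⟨m, hm, rfl⟩
      exact ⟨Submodule.mem_sup_left ⟨m, hm.1, rfl⟩, hsmul m hm.2⟩
    · exact fun m hm => ⟨Submodule.mem_sup_right hm.1, hm.2⟩
    · rintro m ⟨hm, hmn⟩
      obtain ⟨y, ⟨z, hz, rfl⟩, w, hw, rfl⟩ := Submodule.mem_sup.mp hm
      rw [← DirectSum.decompose_of_mem_same ℳ hmn, DirectSum.decompose_add, LinearMap.lsmul_apply]
      refine add_mem ?_ (Submodule.mem_sup_right ⟨h₁ _ hw, SetLike.coe_mem _⟩)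
      rw [decompose_smul_add 𝒮 ℳ hx]
      exact Submodule.mem_sup_left ⟨_, ⟨h₂ n hz, SetLike.coe_mem _⟩, rfl⟩

/-- The Hilbert function of the subquotient `N₂ / N₁`. -/
def subquotientHilbertFunction (N₁ N₂ : Submodule S M) (n : Fin d → ℕ) : ℤ :=
  (Module.length A (gradedPiece ℳ N₂ n)).toNat - (Module.length A (gradedPiece ℳ N₁ n)).toNat

theorem isEventuallyBinomial_subquotientHilbertFunction [IsArtinianRing A] [IsNoetherian S M]
    [SetLike.GradedSMul 𝒮 ℳ] (hX : ∀ x ∈ X, ∃ i, x ∈ 𝒮 (Pi.single i 1))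
    (hXtop : Algebra.adjoin A (X : Set S) = ⊤) {N₁ N₂ : Submodule S M} (hle : N₁ ≤ N₂)
    (h₁ : N₁.IsHomogeneous ℳ) (h₂ : N₂.IsHomogeneous ℳ) :
    IsEventuallyBinomial (subquotientHilbertFunction ℳ N₁ N₂) := by
  classical
  have hlen : ∀ (N : Submodule S M) (n : Fin d → ℕ), Module.length A (gradedPiece ℳ N n) ≠ ⊤ :=
    fun N n => length_gradedPiece_ne_top 𝒮 ℳ hX hXtop inf_le_right
  -- Outer induction on a strict bound for the number of generators not killing `N₂ / N₁`; inner
  -- Noetherian induction enlarges `N₁`, which preserves the bound.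
  obtain ⟨c, hc⟩ : ∃ c, (X.filter fun x => ∃ m ∈ N₂, x • m ∉ N₁).card < c := ⟨_, Nat.lt_succ_self _⟩
  induction c generalizing N₁ N₂ with
  | zero => simp at hc
  | succ c ihc =>
  induction N₁ using WellFoundedGT.induction with
  | ind N₁ ihN =>
  have hanti : ∀ {N : Submodule S M}, N₁ ≤ N →
      (X.filter fun x => ∃ m ∈ N₂, x • m ∉ N).card < c + 1 := fun {N} hN => by
    refine (Finset.card_le_card (Finset.monotone_filter_right X ?_)).trans_lt hc
    rintro x - ⟨m, hm, hxm⟩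
    exact ⟨m, hm, fun h => hxm (hN h)⟩
  by_cases hzd : ∃ x ∈ X, (∃ m ∈ N₂, x • m ∉ N₁) ∧ smulKernel x N₁ N₂ ≠ N₁
  -- On `smulKernel / N₁` the generator `x` acts as zero, so the count drops; for `N₂ / smulKernel`
  -- the lower submodule has grown.
  · obtain ⟨x, hxX, ⟨m, hm, hxm⟩, hne⟩ := hzd
    obtain ⟨i, hi⟩ := hX x hxX
    have hK := isHomogeneous_smulKernel 𝒮 ℳ hi h₁ h₂
    have hN₁K : N₁ ≤ smulKernel x N₁ N₂ := fun y hy => ⟨hle hy, N₁.smul_mem x hy⟩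
    have e : subquotientHilbertFunction ℳ N₁ N₂ =
        subquotientHilbertFunction ℳ N₁ (smulKernel x N₁ N₂) +
          subquotientHilbertFunction ℳ (smulKernel x N₁ N₂) N₂ := by
      ext n
      simp only [Pi.add_apply, subquotientHilbertFunction]
      ring
    rw [e]
    refine (ihc hN₁K h₁ hK ?_).add
      (ihN _ (lt_of_le_of_ne hN₁K hne.symm) inf_le_left hK (hanti hN₁K))
    refine (Finset.card_lt_card ?_).trans_le (Nat.lt_succ_iff.mp hc)
    refine Finset.ssubset_iff_subset_ne.mpr ⟨Finset.monotone_filter_right X ?_, fun h => ?_⟩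
    · rintro y - ⟨z, hz, hyz⟩
      exact ⟨z, hz.1, hyz⟩
    · have hx : x ∈ X.filter fun x => ∃ m ∈ N₂, x • m ∉ N₁ :=
        Finset.mem_filter.mpr ⟨hxX, m, hm, hxm⟩
      rw [← h] at hx
      obtain ⟨-, z, hz, hxz⟩ := Finset.mem_filter.mp hx
      exact hxz hz.2
  · push Not at hzd
    by_cases hact : ∀ i, ∃ x ∈ X, x ∈ 𝒮 (Pi.single i 1) ∧ ∃ m ∈ N₂, x • m ∉ N₁
    -- Each `x i` is injective on `N₂ / N₁`, so the difference in direction `i` is the Hilbert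
    -- function of `N₂ / (x i N₂ + N₁)`, whose lower submodule is strictly larger than `N₁`.
    · choose x hxX hx hxact using hact
      have hle' : ∀ i, N₁ ≤ smulImage (x i) N₁ N₂ := fun i => le_sup_right
      refine isEventuallyBinomial_of_eventually_diff (fun n => ?_)
        (g := fun i => subquotientHilbertFunction ℳ (smulImage (x i) N₁ N₂) N₂)
        (fun i => ihN _ (lt_of_le_of_ne (hle' i) ?_) (sup_le ?_ hle)
          (isHomogeneous_smulImage 𝒮 ℳ (hx i) h₁ h₂) (hanti (hle' i)))
        (fun i => Eventually.of_forall fun n => ?_)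
      · refine sub_nonneg.mpr (Nat.cast_le.mpr (ENat.toNat_le_toNat ?_ (hlen _ _)))
        exact Module.length_le_of_injective
          (Submodule.inclusion fun m hm => ⟨hle hm.1, hm.2⟩ :
            gradedPiece ℳ N₁ n →ₗ[A] gradedPiece ℳ N₂ n) (Submodule.inclusion_injective _)
      · obtain ⟨m, hm, hxm⟩ := hxact i
        exact fun h => hxm (h ▸ Submodule.mem_sup_left ⟨m, hm, rfl⟩)
      · rintro _ ⟨m, hm, rfl⟩
        exact N₂.smul_mem (x i) hm
      · have h := length_gradedPiece_smulImage 𝒮 ℳ (hx i) h₁ h₂ n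
        rw [hzd (x i) (hxX i) (hxact i)] at h
        have h' := congrArg ENat.toNat h
        rw [ENat.toNat_add (hlen _ _) (hlen _ _), ENat.toNat_add (hlen _ _) (hlen _ _)] at h'
        simp only [subquotientHilbertFunction]
        omega
    · push Not at hact
      obtain ⟨i, hi⟩ := hact
      obtain ⟨b, hb⟩ := exists_bound_mem_of_smul_mem 𝒮 ℳ hX hXtop hle h₂ i hi
      refine isEventuallyBinomial_of_eventually_eq_zero
        (eventually_atTop.mpr ⟨fun _ => b + 1, fun n hn => ?_⟩)
      have e : gradedPiece ℳ N₂ n = gradedPiece ℳ N₁ n :=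
        le_antisymm (fun m hm => ⟨hb n (hn i) m hm.1 hm.2, hm.2⟩) fun m hm => ⟨hle hm.1, hm.2⟩
      rw [subquotientHilbertFunction, e, sub_self]

theorem exists_nonnegAtMaximal_length_eq [IsArtinianRing A] [Module.Finite S M]
    [SetLike.GradedSMul 𝒮 ℳ] (hS : IsStandardGraded A 𝒮) :
    (∀ n, Module.length A (ℳ n) ≠ ⊤) ∧ ∃ c, NonnegAtMaximal c ∧
      ∀ᶠ n in atTop, ((Module.length A (ℳ n)).toNat : ℤ) = binomialValue n c := by
  have : Algebra.FiniteType A S := hS.1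
  have : IsNoetherianRing S := Algebra.FiniteType.isNoetherianRing A S
  obtain ⟨X, hXsub, hXtop⟩ := exists_finset_subset_adjoin_eq_top hS.2
  have hX : ∀ x ∈ X, ∃ i, x ∈ 𝒮 (Pi.single i 1) := fun x hx => Set.mem_iUnion.mp (hXsub hx)
  refine ⟨fun n => length_gradedPiece_ne_top 𝒮 ℳ hX hXtop le_rfl, ?_⟩
  obtain ⟨c, hc, h⟩ := isEventuallyBinomial_subquotientHilbertFunction 𝒮 ℳ hX hXtop
    (bot_le : (⊥ : Submodule S M) ≤ ⊤)
    (fun n m hm => by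
      obtain rfl : m = 0 := hm
      simp) fun _ _ _ => Submodule.mem_top
  refine ⟨c, hc, ?_⟩
  filter_upwards [h] with n hn
  have e1 : gradedPiece ℳ (⊤ : Submodule S M) n = ℳ n := by
    ext m
    simp [mem_gradedPiece]
  have e2 : gradedPiece ℳ (⊥ : Submodule S M) n = ⊥ := by
    ext m
    simp only [mem_gradedPiece, Submodule.mem_bot, and_iff_left_iff_imp]
    rintro rfl
    exact zero_mem _
  rw [← hn, subquotientHilbertFunction, e1, e2, Module.length_bot]
  simp

end Graded

/-! ### Additivity along short exact sequences. -/

section ShortExact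

variable {d : ℕ} {A S M M' M'' : Type*} [CommRing A] [CommRing S] [Algebra A S]
  [AddCommGroup M'] [Module A M'] [Module S M'] [IsScalarTower A S M']
  (ℳ' : (Fin d → ℕ) → Submodule A M') [DirectSum.Decomposition ℳ']
  [AddCommGroup M] [Module A M] [Module S M] [IsScalarTower A S M]
  (ℳ : (Fin d → ℕ) → Submodule A M) [DirectSum.Decomposition ℳ]
  [AddCommGroup M''] [Module A M''] [Module S M''] [IsScalarTower A S M'']
  (ℳ'' : (Fin d → ℕ) → Submodule A M'') [DirectSum.Decomposition ℳ'']

theorem decompose_map {f : M' →ₗ[S] M} (hf : ∀ n, ∀ x ∈ ℳ' n, f x ∈ ℳ n) (m : M')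
    (n : Fin d → ℕ) :
    (DirectSum.decompose ℳ (f m) n : M) = f (DirectSum.decompose ℳ' m n : M') := by
  induction m using DirectSum.Decomposition.inductionOn ℳ' with
  | zero => simp
  | @homogeneous j m =>
    by_cases hj : j = n
    · subst hj
      rw [DirectSum.decompose_of_mem_same ℳ (hf j _ m.2), DirectSum.decompose_of_mem_same ℳ' m.2]
    · rw [DirectSum.decompose_of_mem_ne ℳ (hf j _ m.2) hj,
        DirectSum.decompose_of_mem_ne ℳ' m.2 hj, map_zero]
  | add m m' hm hm' =>
    rw [map_add, DirectSum.decompose_add, DirectSum.decompose_add]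
    simp only [DirectSum.add_apply, Submodule.coe_add, hm, hm', map_add]

/-- Exactness passes to degree `n`: the degree `n` component of a preimage of a homogeneous element
of degree `n` is again a preimage. -/
theorem length_eq_add_of_graded_exact {f : M' →ₗ[S] M} {g : M →ₗ[S] M''}
    (hf : ∀ n, ∀ x ∈ ℳ' n, f x ∈ ℳ n) (hg : ∀ n, ∀ x ∈ ℳ n, g x ∈ ℳ'' n)
    (hf_inj : Function.Injective f) (hfg : Function.Exact f g) (hg_surj : Function.Surjective g)
    (n : Fin d → ℕ) :
    Module.length A (ℳ n) = Module.length A (ℳ' n) + Module.length A (ℳ'' n) := by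
  refine Module.length_eq_add_of_exact ((f.restrictScalars A).restrict (hf n))
    ((g.restrictScalars A).restrict (hg n)) (fun x y h => ?_) (fun z => ?_) (fun y => ?_)
  · exact Subtype.ext (hf_inj (congrArg Subtype.val h))
  · obtain ⟨m, hm⟩ := hg_surj z
    refine ⟨DirectSum.decompose ℳ m n, Subtype.ext ?_⟩
    change g (DirectSum.decompose ℳ m n : M) = z
    rw [← decompose_map ℳ ℳ'' hg, hm, DirectSum.decompose_of_mem_same ℳ'' z.2]
  · rw [← Subtype.coe_inj]
    refine (hfg y).trans ⟨?_, ?_⟩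
    · rintro ⟨m, hm⟩
      refine ⟨DirectSum.decompose ℳ' m n, Subtype.ext ?_⟩
      change f (DirectSum.decompose ℳ' m n : M') = y
      rw [← decompose_map ℳ' ℳ hf, hm, DirectSum.decompose_of_mem_same ℳ y.2]
    · rintro ⟨m, rfl⟩
      exact ⟨m, rfl⟩

end ShortExact
end

theorem mainTheorem8 {d : ℕ} (hd : 0 < d)
    {A : Type*} [CommRing A] [IsArtinianRing A] [IsLocalRing A]
    [Infinite (IsLocalRing.ResidueField A)]
    {S : Type*} [CommRing S] [Algebra A S]
    (𝒮 : (Fin d → ℕ) → Submodule A S) [GradedAlgebra 𝒮] (hS : IsStandardGraded A 𝒮)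
    {M' : Type*} [AddCommGroup M'] [Module A M'] [Module S M'] [IsScalarTower A S M']
    (ℳ' : (Fin d → ℕ) → Submodule A M') [DirectSum.Decomposition ℳ'] [SetLike.GradedSMul 𝒮 ℳ']
    [Module.Finite S M']
    {M : Type*} [AddCommGroup M] [Module A M] [Module S M] [IsScalarTower A S M]
    (ℳ : (Fin d → ℕ) → Submodule A M) [DirectSum.Decomposition ℳ] [SetLike.GradedSMul 𝒮 ℳ]
    [Module.Finite S M]
    {M'' : Type*} [AddCommGroup M''] [Module A M''] [Module S M''] [IsScalarTower A S M'']
    (ℳ'' : (Fin d → ℕ) → Submodule A M'') [DirectSum.Decomposition ℳ'']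
    [SetLike.GradedSMul 𝒮 ℳ''] [Module.Finite S M'']
    (f : M' →ₗ[S] M) (g : M →ₗ[S] M'')
    (hf : ∀ n : Fin d → ℕ, ∀ x ∈ ℳ' n, f x ∈ ℳ n)
    (hg : ∀ n : Fin d → ℕ, ∀ x ∈ ℳ n, g x ∈ ℳ'' n)
    (hf_inj : Function.Injective f) (hfg : Function.Exact f g) (hg_surj : Function.Surjective g)
    (k : Fin d → ℕ) :
    (HasHilbertExpansion A ℳ' ∧ HasHilbertExpansion A ℳ ∧ HasHilbertExpansion A ℳ'') ∧
    (MixedMultiplicityDefined A ℳ k ↔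
      MixedMultiplicityDefined A ℳ' k ∧ MixedMultiplicityDefined A ℳ'' k) ∧
    (MixedMultiplicityDefined A ℳ k →
      mixedCoeff A ℳ k = mixedCoeff A ℳ' k + mixedCoeff A ℳ'' k) := by
  obtain ⟨hfin', c', hc', h'⟩ := exists_nonnegAtMaximal_length_eq 𝒮 ℳ' hS
  obtain ⟨hfin, c, hc, h⟩ := exists_nonnegAtMaximal_length_eq 𝒮 ℳ hS
  obtain ⟨hfin'', c'', hc'', h''⟩ := exists_nonnegAtMaximal_length_eq 𝒮 ℳ'' hS
  obtain ⟨hE', he'⟩ := hasHilbertExpansion_and_mixedCoeff_eq hfin' h'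
  obtain ⟨hE, he⟩ := hasHilbertExpansion_and_mixedCoeff_eq hfin h
  obtain ⟨hE'', he''⟩ := hasHilbertExpansion_and_mixedCoeff_eq hfin'' h''
  have hadd : c = c' + c'' := by
    refine eq_of_eventually_binomialValue_eq ?_
    filter_upwards [h', h, h''] with n h1 h2 h3
    rw [map_add, ← h1, ← h2, ← h3,
      length_eq_add_of_graded_exact ℳ' ℳ ℳ'' hf hg hf_inj hfg hg_surj n,
      ENat.toNat_add (hfin' n) (hfin'' n), Nat.cast_add]
  refine ⟨⟨hE', hE, hE''⟩, ?_, fun _ => ?_⟩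
  · simp only [MixedMultiplicityDefined, he', he, he'', hadd]
    exact forall_add_eq_zero_iff hc' hc'' k
  · rw [he', he, he'', hadd, Finsupp.add_apply]
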